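/- Let $(\Omega,\mathcal A,P)$ be a probability space, let $Y$ be a categorical random variable with finitely many values $L_1,\dots,L_K$ and $p_k:=P(Y=L_k)>0$ for every $k$, and let $\mathbf X$ be a random vector in $\mathbb R^d$ with law $F$ that is non-degenerate, i.e. not almost surely equal to a constant. Let $F_k$ be the conditional law of $\mathbf X$ given $Y=L_k$. Let $0<\alpha<2$ and suppose $E\|\mathbf X\|^\alpha<\infty$, where $\|\cdot\|$ is the Euclidean norm. For a probability law $G$ on $\mathbb R^d$ put $\Delta_G(\alpha)=E\|\mathbf Z-\mathbf Z'\|^\alpha$, where $\mathbf Z,\mathbf Z'$ are independent with law $G$; write $\Delta(\alpha)=\Delta_F(\alpha)$ and $\Delta_k(\alpha)=\Delta_{F_k}(\alpha)$. Define the Gini correlation $$\rho_g(\mathbf X,Y;\alpha)=1-\frac{\sum_{k=1}^K p_k\,\Delta_k(\alpha)}{\Delta(\alpha)}.$$ Then: (1) $0\le\rho_g(\mathbf X,Y;\alpha)\le 1$. (2) $\rho_g(\mathbf X,Y;\alpha)=0$ if and only if $\mathbf X$ and $Y$ are independent. (3) $\rho_g(\mathbf X,Y;\alpha)=1$ if and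 only if $F_k$ is a point mass for every $k=1,\dots,K$. (4) $\rho_g(aO\mathbf X+\mathbf b,Y;\alpha)=\rho_g(\mathbf X,Y;\alpha)$ for every orthogonal $d\times d$ real matrix $O$, every real $a\ne 0$ and every $\mathbf b\in\mathbb R^d$. -/

import Mathlib

open MeasureTheory ProbabilityTheory

noncomputable section

/-- The generalized Gini mean difference `E ‖X - X'‖ ^ α` of a distribution `F` on `ℝ^d`,
where `X`, `X'` are independent with law `F`. -/
def giniDiff {d : ℕ} (F : Measure (EuclideanSpace ℝ (Fin d))) (α : ℝ) : ℝ :=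
  ∫ z, ‖z.1 - z.2‖ ^ α ∂(F.prod F)

/-- The conditional law of `X` given `Y = k`. -/
def condLaw {Ω ι : Type*} [MeasurableSpace Ω] (μ : Measure Ω) {d : ℕ}
    (X : Ω → EuclideanSpace ℝ (Fin d)) (Y : Ω → ι) (k : ι) :
    Measure (EuclideanSpace ℝ (Fin d)) :=
  (ProbabilityTheory.cond μ (Y ⁻¹' {k})).map X

/-- The Gini correlation `1 - (∑ k, p_k Δ_k(α)) / Δ(α)` of a random vector `X` and a categorical
variable `Y`, with `p_k = P(Y = k)`. -/
def giniCor {Ω ι : Type*} [MeasurableSpace Ω] [Fintype ι] (μ : Measure Ω) {d : ℕ}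
    (X : Ω → EuclideanSpace ℝ (Fin d)) (Y : Ω → ι) (α : ℝ) : ℝ :=
  1 - (∑ k, μ.real (Y ⁻¹' {k}) * giniDiff (condLaw μ X Y k) α) / giniDiff (μ.map X) α

end

/-! For laws G, H let D(G,H) = 2E‖Z-W‖^α - E‖Z-Z'‖^α - E‖W-W'‖^α be the energy distance. Since F is
the mixture of the F_k with weights p_k, Δ - ∑ p_k Δ_k = ∑ p_k D(F_k, F)
(`giniDiff_sub_sum_condLaw`). For 0 < α < 2, r^α is a positive mixture over u of 1 - exp(-u²r²/2),
and a Gaussian is its own characteristic function up to scaling. So D(G,H) is a positive multiple of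
∫∫ |φ_G(ut) - φ_H(ut)|² dγ(t) u^(-α-1) du, with γ standard Gaussian. Hence D ≥ 0 (`energy_nonneg`),
with equality only for G = H (`eq_of_energy_eq_zero`): this gives the lower bound and (2). The upper
bound and (3) hold because Δ_k ≥ 0 vanishes exactly at point masses. In (4) every Δ is multiplied by
|a|^α. -/

open scoped ComplexConjugate RealInnerProductSpace

/-! ### Powers r^α as Gaussian mixtures -/

section FractionalPower

variable {α : ℝ}

lemma one_sub_exp_neg_sq_nonneg (x : ℝ) : 0 ≤ 1 - Real.exp (-x ^ 2 / 2) := by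
  have : Real.exp (-x ^ 2 / 2) ≤ 1 := Real.exp_le_one_iff.2 (by nlinarith [sq_nonneg x])
  linarith

lemma integrableOn_one_sub_exp_mul_rpow (hα0 : 0 < α) (hα2 : α < 2) :
    IntegrableOn (fun u : ℝ ↦ (1 - Real.exp (-u ^ 2 / 2)) * u ^ (-α - 1)) (Set.Ioi 0) := by
  have hm : Measurable fun u : ℝ ↦ (1 - Real.exp (-u ^ 2 / 2)) * u ^ (-α - 1) := by fun_prop
  rw [← Set.Ioc_union_Ioi_eq_Ioi zero_le_one]
  refine IntegrableOn.union ?_ ?_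
  -- Near 0, 1 - exp(-u²/2) ≤ u² bounds the integrand by u^(1-α), integrable since α < 2.
  · have h : IntegrableOn (fun u : ℝ ↦ u ^ (1 - α)) (Set.Ioc 0 1) := by
      rw [← intervalIntegrable_iff_integrableOn_Ioc_of_le zero_le_one]
      exact intervalIntegral.intervalIntegrable_rpow' (by linarith)
    refine h.mono' hm.aestronglyMeasurable ?_
    refine (ae_restrict_iff' measurableSet_Ioc).2 (.of_forall fun u hu ↦ ?_)
    have hu0 : 0 < u := hu.1
    have h1 := Real.add_one_le_exp (-u ^ 2 / 2)
    rw [Real.norm_of_nonneg (mul_nonneg (one_sub_exp_neg_sq_nonneg u) (by positivity)),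
      show 1 - α = 2 + (-α - 1) by ring, Real.rpow_add hu0]
    gcongr
    norm_num
    nlinarith [sq_nonneg u]
  · refine (integrableOn_Ioi_rpow_of_lt (a := -α - 1) (by linarith) one_pos).mono'
      hm.aestronglyMeasurable ?_
    refine (ae_restrict_iff' measurableSet_Ioi).2 (.of_forall fun u hu ↦ ?_)
    have hu0 : 0 < u := zero_lt_one.trans hu
    rw [Real.norm_of_nonneg (mul_nonneg (one_sub_exp_neg_sq_nonneg u) (by positivity))]
    have := Real.exp_pos (-u ^ 2 / 2)
    exact mul_le_of_le_one_left (by positivity) (by linarith)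

/-- Powers with exponent in `(0, 2)` are mixtures of the functions `1 - exp (-u² r² / 2)`. -/
lemma exists_integral_one_sub_exp_mul_rpow (hα0 : 0 < α) (hα2 : α < 2) :
    ∃ c > 0, ∀ r : ℝ, 0 ≤ r →
      IntegrableOn (fun u : ℝ ↦ (1 - Real.exp (-(u * r) ^ 2 / 2)) * u ^ (-α - 1)) (Set.Ioi 0) ∧
      ∫ u in Set.Ioi (0 : ℝ), (1 - Real.exp (-(u * r) ^ 2 / 2)) * u ^ (-α - 1) = c * r ^ α := by
  have hI := integrableOn_one_sub_exp_mul_rpow hα0 hα2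
  refine ⟨∫ u in Set.Ioi (0 : ℝ), (1 - Real.exp (-u ^ 2 / 2)) * u ^ (-α - 1), ?_, ?_⟩
  · have hpos : ∀ u ∈ Set.Ioi (0 : ℝ), 0 < (1 - Real.exp (-u ^ 2 / 2)) * u ^ (-α - 1) := by
      intro u hu
      have hu0 : 0 < u := hu
      have : Real.exp (-u ^ 2 / 2) < 1 := Real.exp_lt_one_iff.2 (by nlinarith [pow_pos hu0 2])
      exact mul_pos (by linarith) (by positivity)
    rw [gt_iff_lt, setIntegral_pos_iff_support_of_nonneg_ae _ hI]
    · rw [Set.inter_eq_right.2 fun u hu ↦ Function.mem_support.2 (hpos u hu).ne']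
      simp
    · exact (ae_restrict_iff' measurableSet_Ioi).2 (.of_forall fun u hu ↦ (hpos u hu).le)
  · intro r hr
    rcases hr.eq_or_lt with rfl | hr
    · simp [Real.zero_rpow hα0.ne']
    -- Substituting v = r u produces r^(α+1); the Jacobian r⁻¹ leaves r^α.
    have hfun : Set.EqOn
        (fun u : ℝ ↦ (1 - Real.exp (-(u * r) ^ 2 / 2)) * u ^ (-α - 1))
        (fun u : ℝ ↦ r ^ (α + 1) *
          (fun v : ℝ ↦ (1 - Real.exp (-v ^ 2 / 2)) * v ^ (-α - 1)) (r * u)) (Set.Ioi 0) := by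
      intro u hu
      have hu0 : 0 < u := hu
      have h1 : r ^ (α + 1) * r ^ (-α - 1) = 1 := by
        rw [← Real.rpow_add hr]; simp
      simp only [Real.mul_rpow hr.le hu0.le, mul_comm u r]
      linear_combination (-(1 - Real.exp (-(r * u) ^ 2 / 2)) * u ^ (-α - 1)) * h1
    constructor
    · rw [integrableOn_congr_fun hfun measurableSet_Ioi]
      refine Integrable.const_mul ?_ _
      have := (integrableOn_Ioi_comp_mul_left_iff
        (fun v : ℝ ↦ (1 - Real.exp (-v ^ 2 / 2)) * v ^ (-α - 1)) 0 hr)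
      rw [mul_zero] at this
      exact this.2 hI
    · rw [setIntegral_congr_fun measurableSet_Ioi hfun, integral_const_mul,
        integral_comp_mul_left_Ioi (fun v : ℝ ↦ (1 - Real.exp (-v ^ 2 / 2)) * v ^ (-α - 1)) 0 hr,
        mul_zero, smul_eq_mul, Real.rpow_add hr, Real.rpow_one]
      field_simp

end FractionalPower

/-! ### Gaussian kernel and characteristic functions -/

section GaussianKernel

/-- Full support upgrades almost sure equality of continuous functions to equality everywhere. -/
instance isOpenPosMeasure_stdGaussian {ι : Type*} [Fintype ι] :
    (stdGaussian (EuclideanSpace ℝ ι)).IsOpenPosMeasure := by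
  have : (gaussianReal 0 1).IsOpenPosMeasure :=
    (gaussianReal_absolutelyContinuous' 0 one_ne_zero).isOpenPosMeasure
  rw [← map_pi_eq_stdGaussian]
  exact (PiLp.continuous_toLp 2 _).isOpenPosMeasure_map (WithLp.toLp_surjective 2)

variable {E : Type*} [NormedAddCommGroup E] [InnerProductSpace ℝ E] [FiniteDimensional ℝ E]
  [MeasurableSpace E] [BorelSpace E]

/-- The Gaussian kernel of two probability measures, in terms of characteristic functions. -/
lemma integral_gaussian_kernel (G H : Measure E) [IsProbabilityMeasure G] [IsProbabilityMeasure H]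
    (u : ℝ) :
    ∫ z, Real.exp (-(u * ‖z.1 - z.2‖) ^ 2 / 2) ∂(G.prod H) =
      ∫ t, (charFun G (u • t) * conj (charFun H (u • t))).re ∂(stdGaussian E) := by
  have hint : Integrable (Function.uncurry fun (z : E × E) (t : E) ↦
      Complex.exp (⟪t, u • (z.1 - z.2)⟫ * Complex.I)) ((G.prod H).prod (stdGaussian E)) := by
    refine Integrable.of_bound (C := 1) ?_ (.of_forall fun x ↦ ?_)
    · refine Measurable.aestronglyMeasurable ?_
      simp only [Function.uncurry_def]
      fun_prop
    · simp [Function.uncurry_def, Complex.norm_exp_ofReal_mul_I]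
  -- The kernel is the characteristic function of the standard Gaussian at u(z₁ - z₂); Fubini then
  -- exchanges t and z.
  have hL (z : E × E) : ((Real.exp (-(u * ‖z.1 - z.2‖) ^ 2 / 2) : ℝ) : ℂ) =
      ∫ t, Complex.exp (⟪t, u • (z.1 - z.2)⟫ * Complex.I) ∂(stdGaussian E) := by
    rw [← charFun_apply, charFun_stdGaussian, norm_smul, Real.norm_eq_abs, ← Complex.ofReal_pow,
      mul_pow |u|, sq_abs, ← mul_pow]
    push_cast
    rfl
  have hR (t : E) : charFun G (u • t) * conj (charFun H (u • t)) =
      ∫ z : E × E, Complex.exp (⟪t, u • (z.1 - z.2)⟫ * Complex.I) ∂(G.prod H) := by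
    rw [← charFun_neg, charFun_apply, charFun_apply, ← integral_prod_mul]
    congr 1 with z
    rw [← Complex.exp_add, ← add_mul, ← Complex.ofReal_add]
    congr 3
    rw [real_inner_comm, real_inner_comm _ z.2]
    simp only [inner_neg_left, inner_smul_left, inner_smul_right, inner_sub_right]
    simp
    ring
  have key : ((∫ z, Real.exp (-(u * ‖z.1 - z.2‖) ^ 2 / 2) ∂(G.prod H) : ℝ) : ℂ) =
      ∫ t, charFun G (u • t) * conj (charFun H (u • t)) ∂(stdGaussian E) := by
    rw [← integral_complex_ofReal]
    simp_rw [hL, hR]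
    exact integral_integral_swap hint
  have hint' : Integrable (fun t ↦ charFun G (u • t) * conj (charFun H (u • t)))
      (stdGaussian E) := by
    simp_rw [hR]
    exact hint.integral_prod_right
  have := congrArg Complex.re key
  rw [Complex.ofReal_re] at this
  rw [this]
  exact (integral_re hint').symm

/-- Squared maximum mean discrepancy of two probability measures for the Gaussian kernel. -/
lemma gaussian_kernel_energy (G H : Measure E) [IsProbabilityMeasure G] [IsProbabilityMeasure H]
    (u : ℝ) :
    ∫ z, Real.exp (-(u * ‖z.1 - z.2‖) ^ 2 / 2) ∂(G.prod G) +
      ∫ z, Real.exp (-(u * ‖z.1 - z.2‖) ^ 2 / 2) ∂(H.prod H) -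
      2 * ∫ z, Real.exp (-(u * ‖z.1 - z.2‖) ^ 2 / 2) ∂(G.prod H) =
    ∫ t, ‖charFun G (u • t) - charFun H (u • t)‖ ^ 2 ∂(stdGaussian E) := by
  have hI (G H : Measure E) [IsProbabilityMeasure G] [IsProbabilityMeasure H] :
      Integrable (fun t ↦ (charFun G (u • t) * conj (charFun H (u • t))).re) (stdGaussian E) := by
    refine Integrable.of_bound (C := 1) ?_ (.of_forall fun t ↦ ?_)
    · have := measurable_charFun (μ := G)
      have := measurable_charFun (μ := H)
      exact Measurable.aestronglyMeasurable (by fun_prop)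
    · refine (Complex.abs_re_le_norm _).trans ?_
      rw [norm_mul, RCLike.norm_conj]
      exact mul_le_one₀ (norm_charFun_le_one _) (norm_nonneg _) (norm_charFun_le_one _)
  simp_rw [integral_gaussian_kernel]
  rw [← integral_const_mul, ← integral_add (hI G G) (hI H H),
    ← integral_sub (by exact (hI G G).add (hI H H)) ((hI G H).const_mul 2)]
  congr 1 with t
  simp only [Complex.sq_norm, Complex.normSq_apply, Complex.mul_re, Complex.conj_re,
    Complex.conj_im, Complex.sub_re, Complex.sub_im]
  ring

end GaussianKernel

/-! ### Energy distance: positivity and definiteness -/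

section EnergyDistance

variable {E : Type*} [NormedAddCommGroup E] [InnerProductSpace ℝ E] [FiniteDimensional ℝ E]
  [MeasurableSpace E] [BorelSpace E] {α : ℝ}

lemma integrable_norm_sub_rpow {G H : Measure E} [IsProbabilityMeasure G] [IsProbabilityMeasure H]
    (hα0 : 0 < α) (hG : Integrable (fun x ↦ ‖x‖ ^ α) G) (hH : Integrable (fun x ↦ ‖x‖ ^ α) H) :
    Integrable (fun z : E × E ↦ ‖z.1 - z.2‖ ^ α) (G.prod H) := by
  refine (((hG.comp_fst H).add (hH.comp_snd G)).const_mul (2 ^ α)).mono'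
    (Measurable.aestronglyMeasurable (by fun_prop)) (.of_forall fun z ↦ ?_)
  -- Passing through the maximum covers α > 1, where r^α is not subadditive.
  have h1 : ‖z.1 - z.2‖ ≤ 2 * max ‖z.1‖ ‖z.2‖ := by
    have := norm_sub_le z.1 z.2
    have := le_max_left ‖z.1‖ ‖z.2‖
    have := le_max_right ‖z.1‖ ‖z.2‖
    linarith
  rw [Real.norm_of_nonneg (by positivity)]
  calc ‖z.1 - z.2‖ ^ α ≤ (2 * max ‖z.1‖ ‖z.2‖) ^ α := by gcongr
    _ = 2 ^ α * (max ‖z.1‖ ‖z.2‖) ^ α := Real.mul_rpow (by norm_num) (by positivity)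
    _ ≤ 2 ^ α * (‖z.1‖ ^ α + ‖z.2‖ ^ α) := by
      gcongr
      rcases max_cases ‖z.1‖ ‖z.2‖ with ⟨h, _⟩ | ⟨h, _⟩ <;> rw [h]
      · exact le_add_of_nonneg_right (by positivity)
      · exact le_add_of_nonneg_left (by positivity)

/-- Fubini applied to the mixture formula. The constant is chosen before G and H, so the three terms
of the energy distance share it. -/
lemma exists_integral_gaussian_kernel_mul_rpow (hα0 : 0 < α) (hα2 : α < 2) :
    ∃ c > 0, ∀ G H : Measure E, IsProbabilityMeasure G → IsProbabilityMeasure H →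
      Integrable (fun z : E × E ↦ ‖z.1 - z.2‖ ^ α) (G.prod H) →
      IntegrableOn (fun u : ℝ ↦ (1 - ∫ z, Real.exp (-(u * ‖z.1 - z.2‖) ^ 2 / 2) ∂(G.prod H)) *
        u ^ (-α - 1)) (Set.Ioi 0) ∧
      ∫ u in Set.Ioi (0 : ℝ), (1 - ∫ z, Real.exp (-(u * ‖z.1 - z.2‖) ^ 2 / 2) ∂(G.prod H)) *
        u ^ (-α - 1) = c * ∫ z, ‖z.1 - z.2‖ ^ α ∂(G.prod H) := by
  obtain ⟨c, hc, hcr⟩ := exists_integral_one_sub_exp_mul_rpow hα0 hα2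
  refine ⟨c, hc, fun G H _ _ hGH ↦ ?_⟩
  set f : E × E → ℝ → ℝ := fun z u ↦ (1 - Real.exp (-(u * ‖z.1 - z.2‖) ^ 2 / 2)) * u ^ (-α - 1)
    with hf
  have hint : Integrable (Function.uncurry f)
      ((G.prod H).prod (volume.restrict (Set.Ioi (0 : ℝ)))) := by
    rw [integrable_prod_iff (Measurable.aestronglyMeasurable
      (by simp only [hf, Function.uncurry_def]; fun_prop))]
    refine ⟨.of_forall fun z ↦ (hcr ‖z.1 - z.2‖ (norm_nonneg _)).1, ?_⟩
    convert hGH.const_mul c using 2 with z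
    rw [← (hcr ‖z.1 - z.2‖ (norm_nonneg _)).2]
    refine setIntegral_congr_fun measurableSet_Ioi fun u hu ↦ ?_
    have hu0 : 0 < u := hu
    exact Real.norm_of_nonneg (mul_nonneg (one_sub_exp_neg_sq_nonneg _) (by positivity))
  have hk (u : ℝ) : (1 - ∫ z, Real.exp (-(u * ‖z.1 - z.2‖) ^ 2 / 2) ∂(G.prod H)) * u ^ (-α - 1) =
      ∫ z, f z u ∂(G.prod H) := by
    rw [integral_mul_const, integral_sub (integrable_const _)]
    · simp
    · refine Integrable.of_bound (C := 1) (Measurable.aestronglyMeasurable (by fun_prop))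
        (.of_forall fun z ↦ ?_)
      have := one_sub_exp_neg_sq_nonneg (u * ‖z.1 - z.2‖)
      rw [Real.norm_of_nonneg (Real.exp_pos _).le]
      linarith
  simp_rw [hk]
  refine ⟨hint.integral_prod_right, ?_⟩
  rw [← integral_integral_swap hint, ← integral_const_mul]
  congr 1 with z
  exact (hcr ‖z.1 - z.2‖ (norm_nonneg _)).2

/-- The generalized energy distance is a mixture of squared distances of characteristic
functions. -/
lemma exists_energy_eq_integral_charFun (hα0 : 0 < α) (hα2 : α < 2)
    {G H : Measure E} [IsProbabilityMeasure G] [IsProbabilityMeasure H]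
    (hG : Integrable (fun x ↦ ‖x‖ ^ α) G) (hH : Integrable (fun x ↦ ‖x‖ ^ α) H) :
    ∃ c > 0,
      IntegrableOn (fun u : ℝ ↦ (∫ t, ‖charFun G (u • t) - charFun H (u • t)‖ ^ 2
        ∂(stdGaussian E)) * u ^ (-α - 1)) (Set.Ioi 0) ∧
      ∫ u in Set.Ioi (0 : ℝ), (∫ t, ‖charFun G (u • t) - charFun H (u • t)‖ ^ 2
        ∂(stdGaussian E)) * u ^ (-α - 1) =
      c * (2 * ∫ z, ‖z.1 - z.2‖ ^ α ∂(G.prod H) - ∫ z, ‖z.1 - z.2‖ ^ α ∂(G.prod G) -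
        ∫ z, ‖z.1 - z.2‖ ^ α ∂(H.prod H)) := by
  obtain ⟨c, hc, h⟩ := exists_integral_gaussian_kernel_mul_rpow (E := E) hα0 hα2
  obtain ⟨i1, e1⟩ := h G H ‹_› ‹_› (integrable_norm_sub_rpow hα0 hG hH)
  obtain ⟨i2, e2⟩ := h G G ‹_› ‹_› (integrable_norm_sub_rpow hα0 hG hG)
  obtain ⟨i3, e3⟩ := h H H ‹_› ‹_› (integrable_norm_sub_rpow hα0 hH hH)
  refine ⟨c, hc, ?_⟩
  simp_rw [← gaussian_kernel_energy G H]
  -- The constants 1 cancel in 2(1 - K_GH) - (1 - K_GG) - (1 - K_HH), leaving the kernel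
  -- discrepancy.
  have hI := ((i1.const_mul 2).sub i2).sub i3
  have hE := integral_sub ((i1.const_mul 2).sub i2) i3
  simp only [Pi.sub_apply] at hE
  rw [integral_sub (i1.const_mul 2) i2, integral_const_mul, e1, e2, e3] at hE
  constructor
  · refine hI.congr (.of_forall fun u ↦ ?_)
    simp only [Pi.sub_apply]
    ring
  · rw [mul_sub, mul_sub, mul_left_comm, ← hE]
    congr 1 with u
    ring

lemma energy_nonneg (hα0 : 0 < α) (hα2 : α < 2)
    {G H : Measure E} [IsProbabilityMeasure G] [IsProbabilityMeasure H]
    (hG : Integrable (fun x ↦ ‖x‖ ^ α) G) (hH : Integrable (fun x ↦ ‖x‖ ^ α) H) :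
    0 ≤ 2 * ∫ z, ‖z.1 - z.2‖ ^ α ∂(G.prod H) - ∫ z, ‖z.1 - z.2‖ ^ α ∂(G.prod G) -
        ∫ z, ‖z.1 - z.2‖ ^ α ∂(H.prod H) := by
  obtain ⟨c, hc, -, h⟩ := exists_energy_eq_integral_charFun hα0 hα2 hG hH
  refine nonneg_of_mul_nonneg_right ?_ hc
  rw [← h]
  refine setIntegral_nonneg measurableSet_Ioi fun u hu ↦ ?_
  have hu0 : 0 < u := hu
  exact mul_nonneg (integral_nonneg fun t ↦ by positivity) (by positivity)

/-- A single u > 0 with vanishing inner integral suffices: the characteristic functions then agree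
at u t for γ-almost every t, hence for all t by continuity and full support, and t ↦ u t is onto. -/
lemma eq_of_energy_eq_zero {ι : Type*} [Fintype ι] (hα0 : 0 < α) (hα2 : α < 2)
    {G H : Measure (EuclideanSpace ℝ ι)} [IsProbabilityMeasure G] [IsProbabilityMeasure H]
    (hG : Integrable (fun x ↦ ‖x‖ ^ α) G) (hH : Integrable (fun x ↦ ‖x‖ ^ α) H)
    (h0 : 2 * ∫ z, ‖z.1 - z.2‖ ^ α ∂(G.prod H) - ∫ z, ‖z.1 - z.2‖ ^ α ∂(G.prod G) -
        ∫ z, ‖z.1 - z.2‖ ^ α ∂(H.prod H) = 0) : G = H := by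
  obtain ⟨c, -, hi, h⟩ := exists_energy_eq_integral_charFun hα0 hα2 hG hH
  rw [h0, mul_zero, setIntegral_eq_zero_iff_of_nonneg_ae _ hi] at h
  · obtain ⟨u, hu, hu0⟩ : ∃ u : ℝ, (∫ t, ‖charFun G (u • t) - charFun H (u • t)‖ ^ 2
        ∂(stdGaussian (EuclideanSpace ℝ ι))) * u ^ (-α - 1) = 0 ∧ 0 < u := by
      have : (ae (volume.restrict (Set.Ioi (0 : ℝ)))).NeBot := by
        rw [ae_neBot, Ne, Measure.restrict_eq_zero]
        simp
      exact (h.and (ae_restrict_mem measurableSet_Ioi)).exists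
    have hu1 : u ^ (-α - 1) ≠ 0 := by positivity
    have hcont (G : Measure (EuclideanSpace ℝ ι)) [IsProbabilityMeasure G] :
        Continuous fun t ↦ charFun G (u • t) := by
      have := continuous_charFun (μ := G)
      fun_prop
    have hz := (mul_eq_zero.1 hu).resolve_right hu1
    rw [integral_eq_zero_iff_of_nonneg (fun t ↦ by positivity)] at hz
    · have hz' := (Continuous.ae_eq_iff_eq (stdGaussian (EuclideanSpace ℝ ι))
        (((hcont G).sub (hcont H)).norm.pow 2) continuous_const).1 hz
      refine Measure.ext_of_charFun (funext fun t ↦ ?_)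
      have := congrFun hz' (u⁻¹ • t)
      have h1 : ‖charFun G (u • u⁻¹ • t) - charFun H (u • u⁻¹ • t)‖ ^ 2 = 0 := this
      rw [smul_smul, mul_inv_cancel₀ hu0.ne', one_smul] at h1
      exact sub_eq_zero.1 (norm_eq_zero.1 (pow_eq_zero_iff two_ne_zero |>.1 h1))
    · refine Integrable.of_bound (C := 2 ^ 2)
        (((hcont G).sub (hcont H)).norm.pow 2).aestronglyMeasurable (.of_forall fun t ↦ ?_)
      rw [norm_pow, norm_norm]
      gcongr
      refine (norm_sub_le _ _).trans ?_
      have := norm_charFun_le_one (μ := G) (u • t)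
      have := norm_charFun_le_one (μ := H) (u • t)
      linarith
  · refine (ae_restrict_iff' measurableSet_Ioi).2 (.of_forall fun u hu ↦ ?_)
    have hu0 : 0 < u := hu
    exact mul_nonneg (integral_nonneg fun t ↦ by positivity) (by positivity)

end EnergyDistance

/-! ### Gini mean difference: vanishing and scaling -/

section GiniDiff

variable {d : ℕ} {α : ℝ} {F : Measure (EuclideanSpace ℝ (Fin d))}

lemma giniDiff_nonneg (F : Measure (EuclideanSpace ℝ (Fin d))) (α : ℝ) : 0 ≤ giniDiff F α :=
  integral_nonneg fun _ ↦ by positivity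

lemma giniDiff_eq_zero_iff [IsProbabilityMeasure F] (hα0 : 0 < α)
    (hF : Integrable (fun x ↦ ‖x‖ ^ α) F) :
    giniDiff F α = 0 ↔ ∃ c, F = Measure.dirac c := by
  constructor
  · intro h
    rw [giniDiff, integral_eq_zero_iff_of_nonneg (fun _ ↦ by positivity)
      (integrable_norm_sub_rpow hα0 hF hF)] at h
    -- Some slice of the product already forces almost every y to equal its base point c.
    obtain ⟨c, hc⟩ := (Measure.ae_ae_of_ae_prod h).exists
    refine ⟨c, ?_⟩
    have hc' : ∀ᵐ y ∂F, id y = c := by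
      filter_upwards [hc] with y hy
      have hy' : ‖c - y‖ ^ α = 0 := hy
      rw [Real.rpow_eq_zero (norm_nonneg _) hα0.ne', norm_sub_eq_zero_iff] at hy'
      exact hy'.symm
    have : F.map id = F.map fun _ ↦ c := Measure.map_congr hc'
    rw [Measure.map_id, Measure.map_const] at this
    simpa using this
  · rintro ⟨c, rfl⟩
    simp [giniDiff, Measure.dirac_prod_dirac, Real.zero_rpow hα0.ne']

lemma giniDiff_map_of_norm_sub [IsProbabilityMeasure F]
    {f : EuclideanSpace ℝ (Fin d) → EuclideanSpace ℝ (Fin d)} (hf : Measurable f) {c : ℝ}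
    (hc : 0 ≤ c) (h : ∀ x y, ‖f x - f y‖ = c * ‖x - y‖) :
    giniDiff (F.map f) α = c ^ α * giniDiff F α := by
  rw [giniDiff, Measure.map_prod_map F F hf hf, integral_map (by fun_prop)
    (Measurable.aestronglyMeasurable (by fun_prop)), giniDiff, ← integral_const_mul]
  congr 1 with z
  rw [Prod.map_fst, Prod.map_snd, h, Real.mul_rpow hc (norm_nonneg _)]

end GiniDiff

lemma norm_toEuclideanLin_of_mem_orthogonalGroup {n : Type*} [Fintype n] [DecidableEq n]
    {O : Matrix n n ℝ} (hO : O ∈ Matrix.orthogonalGroup n ℝ) (x : EuclideanSpace ℝ n) :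
    ‖Matrix.toEuclideanLin O x‖ = ‖x‖ := by
  have h : star O * O = 1 := (Matrix.mem_orthogonalGroup_iff' n ℝ).1 hO
  rw [Matrix.star_eq_conjTranspose, Matrix.conjTranspose_eq_transpose_of_trivial] at h
  rw [← sq_eq_sq₀ (norm_nonneg _) (norm_nonneg _), EuclideanSpace.real_norm_sq_eq,
    EuclideanSpace.real_norm_sq_eq]
  simp only [Matrix.ofLp_toLpLin, Matrix.toLin'_apply, pow_two]
  change O.mulVec x.ofLp ⬝ᵥ O.mulVec x.ofLp = x.ofLp ⬝ᵥ x.ofLp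
  rw [Matrix.dotProduct_mulVec, Matrix.vecMul_mulVec, h, Matrix.vecMul_one]

/-! ### Conditional laws and the between-group decomposition -/

section CondLaw

variable {Ω ι : Type*} [MeasurableSpace Ω] {μ : Measure Ω}
  {d : ℕ} {X : Ω → EuclideanSpace ℝ (Fin d)} {Y : Ω → ι}

lemma integrable_condLaw (hX : Measurable X) {k : ι} (hk : 0 < μ (Y ⁻¹' {k}))
    {f : EuclideanSpace ℝ (Fin d) → ℝ} (hf : Integrable f (μ.map X)) :
    Integrable f (condLaw μ X Y k) := by
  have h : Integrable f ((μ.restrict (Y ⁻¹' {k})).map X) :=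
    hf.mono_measure (Measure.map_mono Measure.restrict_le_self hX)
  rw [condLaw, ProbabilityTheory.cond, Measure.map_smul]
  exact h.smul_measure (ENNReal.inv_ne_top.2 hk.ne')

lemma condLaw_apply [MeasurableSpace ι] [MeasurableSingletonClass ι]
    (hX : Measurable X) (hY : Measurable Y) (k : ι)
    {s : Set (EuclideanSpace ℝ (Fin d))} (hs : MeasurableSet s) :
    condLaw μ X Y k s = (μ (Y ⁻¹' {k}))⁻¹ * μ (Y ⁻¹' {k} ∩ X ⁻¹' s) := by
  rw [condLaw, Measure.map_apply hX hs, cond_apply (hY (measurableSet_singleton k))]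

variable [IsProbabilityMeasure μ]

lemma isProbabilityMeasure_condLaw (hX : Measurable X) {k : ι} (hk : 0 < μ (Y ⁻¹' {k})) :
    IsProbabilityMeasure (condLaw μ X Y k) :=
  have := cond_isProbabilityMeasure hk.ne'
  Measure.isProbabilityMeasure_map hX.aemeasurable

variable [MeasurableSpace ι] [MeasurableSingletonClass ι] [Fintype ι]

lemma sum_smul_condLaw (hX : Measurable X) (hY : Measurable Y) :
    ∑ k, μ (Y ⁻¹' {k}) • condLaw μ X Y k = μ.map X := by
  conv_rhs => rw [← sum_meas_smul_cond_fiber hY μ]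
  simp_rw [← Measure.mapₗ_apply_of_measurable hX, map_sum, map_smul,
    Measure.mapₗ_apply_of_measurable hX]
  rfl

lemma integral_eq_sum_condLaw (hX : Measurable X) (hY : Measurable Y)
    (hp : ∀ k, 0 < μ (Y ⁻¹' {k})) {f : EuclideanSpace ℝ (Fin d) → ℝ}
    (hf : Integrable f (μ.map X)) :
    ∫ x, f x ∂(μ.map X) = ∑ k, μ.real (Y ⁻¹' {k}) * ∫ x, f x ∂(condLaw μ X Y k) := by
  rw [← sum_smul_condLaw (μ := μ) hX hY, integral_finsetSum_measure]
  · simp_rw [integral_smul_measure, smul_eq_mul, measureReal_def]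
  · exact fun k _ ↦ (integrable_condLaw hX (hp k) hf).smul_measure (measure_ne_top _ _)

lemma indepFun_iff_condLaw_eq (hX : Measurable X) (hY : Measurable Y)
    (hp : ∀ k, 0 < μ (Y ⁻¹' {k})) :
    IndepFun X Y μ ↔ ∀ k, condLaw μ X Y k = μ.map X := by
  constructor
  · intro h k
    ext s hs
    rw [condLaw_apply hX hY k hs, Measure.map_apply hX hs, Set.inter_comm,
      h.measure_inter_preimage_eq_mul s {k} hs (measurableSet_singleton k), mul_comm (μ (X ⁻¹' s)),
      ← mul_assoc, ENNReal.inv_mul_cancel (hp k).ne' (measure_ne_top _ _), one_mul]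
  · intro h
    rw [indepFun_iff_measure_inter_preimage_eq_mul]
    intro s t hs ht
    have hsing (k : ι) : μ (X ⁻¹' s ∩ Y ⁻¹' {k}) = μ (X ⁻¹' s) * μ (Y ⁻¹' {k}) := by
      have := congrArg (· s) (h k)
      simp only [condLaw_apply hX hY k hs, Measure.map_apply hX hs] at this
      rw [← this, mul_comm, ← mul_assoc, ENNReal.mul_inv_cancel (hp k).ne' (measure_ne_top _ _),
        one_mul, Set.inter_comm]
    -- As ι is finite, independence reduces to the single fibres of Y.
    have hfib {A : Set Ω} (hA : MeasurableSet A) :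
        μ (A ∩ Y ⁻¹' t) = ∑ k ∈ t.toFinite.toFinset, μ (A ∩ Y ⁻¹' {k}) := by
      rw [← measure_biUnion_finset]
      · congr 1
        ext ω
        simp
      · intro i _ j _ hij
        refine Set.disjoint_left.2 fun ω h1 h2 ↦ hij ?_
        exact h1.2.symm.trans h2.2
      · exact fun k _ ↦ hA.inter (hY (measurableSet_singleton k))
    have h1 := hfib (hX hs)
    have h2 := hfib MeasurableSet.univ
    simp only [Set.univ_inter] at h2
    rw [h1, h2, Finset.mul_sum]
    exact Finset.sum_congr rfl fun k _ ↦ hsing k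

/-- The between-group variation is the weighted sum of the energy distances between the
conditional laws and the marginal law. -/
lemma giniDiff_sub_sum_condLaw (hX : Measurable X) (hY : Measurable Y)
    (hp : ∀ k, 0 < μ (Y ⁻¹' {k})) {α : ℝ} (hα0 : 0 < α)
    (hF : Integrable (fun x ↦ ‖x‖ ^ α) (μ.map X)) :
    giniDiff (μ.map X) α - ∑ k, μ.real (Y ⁻¹' {k}) * giniDiff (condLaw μ X Y k) α =
      ∑ k, μ.real (Y ⁻¹' {k}) *
        (2 * ∫ z, ‖z.1 - z.2‖ ^ α ∂((condLaw μ X Y k).prod (μ.map X)) -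
          ∫ z, ‖z.1 - z.2‖ ^ α ∂((condLaw μ X Y k).prod (condLaw μ X Y k)) -
          ∫ z, ‖z.1 - z.2‖ ^ α ∂((μ.map X).prod (μ.map X))) := by
  have hprob (k) := isProbabilityMeasure_condLaw (X := X) hX (hp k)
  have : IsProbabilityMeasure (μ.map X) := Measure.isProbabilityMeasure_map hX.aemeasurable
  have hsum : ∑ k, μ.real (Y ⁻¹' {k}) = 1 := by
    have h := congrArg (· Set.univ) (sum_smul_condLaw (μ := μ) hX hY)
    simp only [Measure.coe_finsetSum, Finset.sum_apply, Measure.smul_apply, measure_univ,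
      smul_eq_mul, mul_one] at h
    simp_rw [measureReal_def]
    rw [← ENNReal.toReal_sum fun k _ ↦ measure_ne_top _ _, h, ENNReal.toReal_one]
  -- Averaging the first variable over the groups restores F, so the cross terms contribute 2Δ - Δ =
  -- Δ.
  have hcross : ∑ k, μ.real (Y ⁻¹' {k}) *
      ∫ z, ‖z.1 - z.2‖ ^ α ∂((condLaw μ X Y k).prod (μ.map X)) = giniDiff (μ.map X) α := by
    have hi := integrable_norm_sub_rpow hα0 hF hF
    have hk (k) := integrable_norm_sub_rpow hα0 (integrable_condLaw (Y := Y) hX (hp k) hF) hF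
    rw [giniDiff, integral_prod _ hi, integral_eq_sum_condLaw hX hY hp hi.integral_prod_left]
    exact Finset.sum_congr rfl fun k _ ↦ by rw [integral_prod _ (hk k)]
  simp only [mul_sub, Finset.sum_sub_distrib, ← Finset.sum_mul, hsum]
  simp only [mul_left_comm _ (2 : ℝ), ← Finset.mul_sum, hcross, giniDiff]
  ring

end CondLaw

/-! ### The four properties of the Gini correlation -/

theorem theorem1 {Ω ι : Type*} [MeasurableSpace Ω] (μ : Measure Ω) [IsProbabilityMeasure μ]
    [Fintype ι] [MeasurableSpace ι] [MeasurableSingletonClass ι] (d : ℕ)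
    (X : Ω → EuclideanSpace ℝ (Fin d)) (hX : Measurable X)
    (Y : Ω → ι) (hY : Measurable Y) (hp : ∀ k, 0 < μ (Y ⁻¹' {k}))
    (hnd : ¬ ∃ c, ∀ᵐ ω ∂μ, X ω = c)
    (α : ℝ) (hα0 : 0 < α) (hα2 : α < 2)
    (hint : Integrable (fun ω => ‖X ω‖ ^ α) μ) :
    (0 ≤ giniCor μ X Y α ∧ giniCor μ X Y α ≤ 1) ∧
    (giniCor μ X Y α = 0 ↔ IndepFun X Y μ) ∧
    (giniCor μ X Y α = 1 ↔ ∀ k, ∃ c, condLaw μ X Y k = Measure.dirac c) ∧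
    (∀ O ∈ Matrix.orthogonalGroup (Fin d) ℝ, ∀ a : ℝ, a ≠ 0 →
      ∀ b : EuclideanSpace ℝ (Fin d),
        giniCor μ (fun ω => a • Matrix.toEuclideanLin O (X ω) + b) Y α = giniCor μ X Y α) := by
  have hF : Integrable (fun x ↦ ‖x‖ ^ α) (μ.map X) :=
    (integrable_map_measure (Measurable.aestronglyMeasurable (by fun_prop)) hX.aemeasurable).2 hint
  have hFk (k) := integrable_condLaw (Y := Y) hX (hp k) hF
  have hprob (k) := isProbabilityMeasure_condLaw (X := X) hX (hp k)
  have : IsProbabilityMeasure (μ.map X) := Measure.isProbabilityMeasure_map hX.aemeasurable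
  have hp' (k) : 0 < μ.real (Y ⁻¹' {k}) := ENNReal.toReal_pos (hp k).ne' (measure_ne_top _ _)
  -- Non-degeneracy is what makes the denominator nonzero.
  have hpos : 0 < giniDiff (μ.map X) α := by
    refine lt_of_le_of_ne (giniDiff_nonneg _ _) fun h ↦ hnd ?_
    obtain ⟨c, hc⟩ := (giniDiff_eq_zero_iff hα0 hF).1 h.symm
    refine ⟨c, ae_of_ae_map (p := (· = c)) hX.aemeasurable ?_⟩
    rw [hc]
    exact (ae_dirac_iff (measurableSet_singleton c)).2 rfl
  have hE := giniDiff_sub_sum_condLaw hX hY hp hα0 hF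
  have hEk (k) := energy_nonneg hα0 hα2 (hFk k) hF
  have hS (k) (_ : k ∈ Finset.univ) :
      0 ≤ μ.real (Y ⁻¹' {k}) * giniDiff (condLaw μ X Y k) α :=
    mul_nonneg (hp' k).le (giniDiff_nonneg _ _)
  refine ⟨⟨?_, ?_⟩, ?_, ?_, ?_⟩
  · rw [giniCor, sub_nonneg, div_le_one hpos, ← sub_nonneg, hE]
    exact Finset.sum_nonneg fun k _ ↦ mul_nonneg (hp' k).le (hEk k)
  · rw [giniCor, sub_le_self_iff]
    exact div_nonneg (Finset.sum_nonneg hS) hpos.le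
  · rw [giniCor, sub_eq_zero, eq_comm, div_eq_one_iff_eq hpos.ne', eq_comm, ← sub_eq_zero, hE,
      Finset.sum_eq_zero_iff_of_nonneg fun k _ ↦ mul_nonneg (hp' k).le (hEk k),
      indepFun_iff_condLaw_eq hX hY hp]
    refine ⟨fun h k ↦ ?_, fun h k _ ↦ ?_⟩
    · exact eq_of_energy_eq_zero hα0 hα2 (hFk k) hF
        ((mul_eq_zero.1 (h k (Finset.mem_univ k))).resolve_left (hp' k).ne')
    · rw [h k]
      ring
  · rw [giniCor, sub_eq_self, div_eq_zero_iff, or_iff_left hpos.ne',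
      Finset.sum_eq_zero_iff_of_nonneg hS]
    refine forall_congr' fun k ↦ ?_
    rw [← giniDiff_eq_zero_iff hα0 (hFk k)]
    simp [(hp' k).ne']
  · intro O hO a ha b
    set f : EuclideanSpace ℝ (Fin d) → EuclideanSpace ℝ (Fin d) :=
      fun x ↦ a • Matrix.toEuclideanLin O x + b
    have hf : Measurable f := by
      have : Continuous (Matrix.toEuclideanLin O) := LinearMap.continuous_of_finiteDimensional _
      exact ((this.const_smul a).add_const b).measurable
    have hnorm (x y) : ‖f x - f y‖ = |a| * ‖x - y‖ := by
      have : f x - f y = a • Matrix.toEuclideanLin O (x - y) := by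
        simp only [f, map_sub, smul_sub]
        abel
      rw [this, norm_smul, Real.norm_eq_abs, norm_toEuclideanLin_of_mem_orthogonalGroup hO]
    have hmap (G : Measure (EuclideanSpace ℝ (Fin d))) [IsProbabilityMeasure G] :
        giniDiff (G.map f) α = |a| ^ α * giniDiff G α :=
      giniDiff_map_of_norm_sub hf (abs_nonneg a) hnorm
    have hcond (k) : condLaw μ (fun ω ↦ f (X ω)) Y k = (condLaw μ X Y k).map f :=
      (Measure.map_map hf hX).symm
    have hlaw : μ.map (fun ω ↦ f (X ω)) = (μ.map X).map f := (Measure.map_map hf hX).symm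
    change giniCor μ (fun ω ↦ f (X ω)) Y α = _
    have hapos : |a| ^ α ≠ 0 := (Real.rpow_pos_of_pos (abs_pos.2 ha) α).ne'
    simp_rw [giniCor, hcond, hlaw, hmap, mul_left_comm _ (|a| ^ α), ← Finset.mul_sum]
    rw [mul_div_mul_left _ _ hapos]
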